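/- **Conventions.** Every quantum system is a tensor product of finitely many qudits of odd prime dimension (the empty product is the trivial one-dimensional system). For a qudit of dimension $d$ with basis $|j\rangle$, $j\in\mathbb Z_d$, put $X|j\rangle=|j+1\rangle$, $Z|j\rangle=e^{2\pi i j/d}|j\rangle$, $\tau=e^{(d+1)\pi i/d}$ and $T_{(a_1,a_2)}=\tau^{-a_1a_2}Z^{a_1}X^{a_2}$ for $(a_1,a_2)\in\mathbb Z_d\times\mathbb Z_d$; for composite systems $T_{u\oplus v}=T_u\otimes T_v$. For a system of dimension $d$, the phase-space point operators are $A^0=\frac1d\sum_u T_u$ and $A^u=T_uA^0T_u^\dagger$, and the discrete Wigner function of an operator $V$ is $W_V(u)=\frac1d\operatorname{Tr}[A^uV]$. Let $\mathcal W_+$ be the set of states with non-negative Wigner function. A Hermiticity-preserving linear map $\mathcal N_{A\to B}$ is *CPWP* if for every system $R$ the map $\mathrm{id}_R\otimes\mathcal N$ sends $\mathcal W_+$ on $RA$ into $\mathcal W_+$ on $RB$. A *channel* is a completely positive trace-preserving linear map. A *superchannel* $\Xi_{(A\to B)\to(C\to D)}$ is a linear map from linear maps $A\to B$ (on operators) to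 linear maps $C\to D$ such that $(\mathrm{id}_R\otimes\Xi)(\mathcal N_{RA\to RB})$ is a channel $RC\to RD$ for every finite-dimensional $R$ and every channel $\mathcal N_{RA\to RB}$. It is *CPWP* if $(\mathrm{id}_R\otimes\Xi)(\mathcal N_{RA\to RB})$ is CPWP for every reference system $R$ and every CPWP channel $\mathcal N_{RA\to RB}$. Its bipartite map $\mathcal P_{CB\to AD}$ is given by $$\langle k,s|\,\mathcal P(|i\rangle\langle i'|_C\otimes|l\rangle\langle l'|_B)\,|k',s'\rangle=\langle s|\,\Xi\big(Y\mapsto\langle k|Y|k'\rangle\,|l\rangle\langle l'|\big)(|i\rangle\langle i'|)\,|s'\rangle$$ (so $\mathcal P=\mathcal D_{BM\to D}\circ\mathcal E_{C\to AM}$ whenever $\Xi(\mathcal N)=\mathcal D_{BM\to D}\circ\mathcal N_{A\to B}\circ\mathcal E_{C\to AM}$ for all $\mathcal N$). Its Choi operator $J^\Xi_{CBAD}$ is the Choi operator $\sum_{x,y}|x\rangle\langle y|_{CB}\otimes\mathcal P(|x\rangle\langle y|)$ of $\mathcal P$, and its Wigner function is $$W_\Xi(u_A,v_D|u_C,v_B)=\frac1{d_Ad_D}\operatorname{Tr}\big[(A_A^{u_A}\otimes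 A_D^{v_D})\,\mathcal P_{CB\to AD}(A_C^{u_C}\otimes A_B^{v_B})\big].$$ **Theorem.** Let $\Xi_{(A\to B)\to(C\to D)}$ be a quantum superchannel. The following are equivalent: 1. $\Xi$ is a CPWP superchannel; 2. the discrete Wigner function of the Choi operator $J^\Xi_{CBAD}$ is non-negative; 3. $W_\Xi(u_A,v_D|u_C,v_B)\ge 0$ for all $u_A,v_D,u_C,v_B$; 4. $W_\Xi$ is a classical bipartite channel with a non-signalling constraint, that is, $W_\Xi(u_A,v_D|u_C,v_B)\ge0$ and $\sum_{u_A,v_D}W_\Xi(u_A,v_D|u_C,v_B)=1$ for all arguments, and $\sum_{v_D}W_\Xi(u_A,v_D|u_C,v_B)$ does not depend on $v_B$. -/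

import Mathlib

open Matrix
open scoped Kronecker ComplexOrder

noncomputable section

/-! ### Quantum systems and discrete phase space -/

/-- Quantum systems: tensor products of finitely many qudits of odd prime dimension
(the empty product being the trivial one-dimensional system). -/
inductive QSystem : Type
  | trivial : QSystem
  | qudit (d : ℕ) (prime : d.Prime) (odd : Odd d) : QSystem
  | tensor (A B : QSystem) : QSystem

namespace QSystem

/-- Labels of the computational basis. -/
@[reducible] def Basis : QSystem → Type
  | trivial => Unit
  | qudit d _ _ => ZMod d
  | tensor A B => A.Basis × B.Basis

/-- Points of the discrete phase space: `ℤ_d × ℤ_d` for a qudit, products for composite systems. -/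
@[reducible] def Phase : QSystem → Type
  | trivial => Unit
  | qudit d _ _ => ZMod d × ZMod d
  | tensor A B => A.Phase × B.Phase

instance instFintypeBasis : (S : QSystem) → Fintype S.Basis
  | trivial => inferInstanceAs (Fintype Unit)
  | qudit d hd _ =>
    haveI : NeZero d := ⟨hd.ne_zero⟩
    inferInstanceAs (Fintype (ZMod d))
  | tensor A B =>
    haveI := instFintypeBasis A
    haveI := instFintypeBasis B
    inferInstanceAs (Fintype (A.Basis × B.Basis))

instance instDecidableEqBasis : (S : QSystem) → DecidableEq S.Basis
  | trivial => inferInstanceAs (DecidableEq Unit)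
  | qudit d _ _ => inferInstanceAs (DecidableEq (ZMod d))
  | tensor A B =>
    haveI := instDecidableEqBasis A
    haveI := instDecidableEqBasis B
    inferInstanceAs (DecidableEq (A.Basis × B.Basis))

instance instFintypePhase : (S : QSystem) → Fintype S.Phase
  | trivial => inferInstanceAs (Fintype Unit)
  | qudit d hd _ =>
    haveI : NeZero d := ⟨hd.ne_zero⟩
    inferInstanceAs (Fintype (ZMod d × ZMod d))
  | tensor A B =>
    haveI := instFintypePhase A
    haveI := instFintypePhase B
    inferInstanceAs (Fintype (A.Phase × B.Phase))

/-- The Hilbert space dimension. -/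
def dim (S : QSystem) : ℕ := Fintype.card S.Basis

/-- Operators on the Hilbert space of the system, in the computational basis. -/
abbrev Op (S : QSystem) : Type := Matrix S.Basis S.Basis ℂ

/-- The shift operator `X|j⟩ = |j + 1⟩`. -/
def shiftX (d : ℕ) : Matrix (ZMod d) (ZMod d) ℂ :=
  Matrix.of fun j k => if j = k + 1 then 1 else 0

/-- The boost operator `Z|j⟩ = ω^j |j⟩`, `ω = e^{2πi/d}`. -/
def boostZ (d : ℕ) : Matrix (ZMod d) (ZMod d) ℂ :=
  Matrix.diagonal fun j => Complex.exp (2 * Real.pi * Complex.I / d) ^ j.val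

/-- The Heisenberg–Weyl operators `T_u`: for a qudit and `u = (a₁, a₂)`,
`T_u = τ^{-a₁a₂} Z^{a₁} X^{a₂}` with `τ = e^{(d+1)πi/d}`; for a composite system,
`T_{u ⊕ v} = T_u ⊗ T_v`. (For odd `d` one has `τ^d = 1`, so the choice of representatives
of `a₁, a₂ ∈ ℤ_d` is immaterial.) -/
def weyl : (S : QSystem) → S.Phase → S.Op
  | trivial, _ => 1
  | qudit d hd _, u =>
    haveI : NeZero d := ⟨hd.ne_zero⟩
    (Complex.exp ((d + 1) * Real.pi * Complex.I / d) ^ (-((u.1.val * u.2.val : ℕ) : ℤ))) •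
      (boostZ d ^ u.1.val * shiftX d ^ u.2.val)
  | tensor A B, u => weyl A u.1 ⊗ₖ weyl B u.2

/-- `A_0 = (1/d) ∑_u T_u`. -/
def phasePointZero (S : QSystem) : S.Op := (1 / (S.dim : ℂ)) • ∑ u, S.weyl u

/-- The phase-space point operators `A_u = T_u A_0 T_u†`. -/
def phasePoint (S : QSystem) (u : S.Phase) : S.Op :=
  S.weyl u * S.phasePointZero * (S.weyl u)ᴴ

/-- The discrete Wigner function `W_X(u) = (1/d) Tr[A_u X]`. It is kept complex valued; it is real
when `X` is Hermitian, and `0 ≤ z` for `z : ℂ` means that `z` is real and non-negative. -/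
def wigner (S : QSystem) (X : S.Op) (u : S.Phase) : ℂ :=
  (1 / (S.dim : ℂ)) * (S.phasePoint u * X).trace

/-- `W₊`: quantum states with non-negative discrete Wigner function. -/
def wignerStates (S : QSystem) : Set S.Op :=
  {ρ | ρ.PosSemidef ∧ ρ.trace = 1 ∧ ∀ u, 0 ≤ S.wigner ρ u}

end QSystem

/-! ### Linear maps on operators, channels -/

/-- Linear maps from operators on `ℂ^m` to operators on `ℂ^n`. -/
abbrev OpMap (m n : Type) : Type := Matrix m m ℂ →ₗ[ℂ] Matrix n n ℂ

/-- The map `id_R ⊗ N`. -/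
def idTensor (r : Type) {m n : Type} (N : OpMap m n) : OpMap (r × m) (r × n) where
  toFun X := Matrix.of fun p q => N (Matrix.of fun i j => X (p.1, i) (q.1, j)) p.2 q.2
  map_add' X Y := by
    ext p q
    exact congrFun (congrFun (N.map_add (Matrix.of fun i j => X (p.1, i) (q.1, j))
      (Matrix.of fun i j => Y (p.1, i) (q.1, j))) p.2) q.2
  map_smul' c X := by
    ext p q
    exact congrFun (congrFun (N.map_smul c (Matrix.of fun i j => X (p.1, i) (q.1, j))) p.2) q.2

def IsHermiticityPreserving {m n : Type} (N : OpMap m n) : Prop :=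
  ∀ X, X.IsHermitian → (N X).IsHermitian

def IsCompletelyPositive {m n : Type} (N : OpMap m n) : Prop :=
  ∀ (r : Type) [Fintype r] [DecidableEq r] (X : Matrix (r × m) (r × m) ℂ),
    X.PosSemidef → (idTensor r N X).PosSemidef

/-- Quantum channels: completely positive trace-preserving linear maps. -/
def IsChannel {m n : Type} [Fintype m] [Fintype n] (N : OpMap m n) : Prop :=
  IsCompletelyPositive N ∧ ∀ X, (N X).trace = X.trace

/-- The Choi operator `J^N = ∑_{ij} |i⟩⟨j| ⊗ N(|i⟩⟨j|)`. -/
def choi {m n : Type} [Fintype m] [DecidableEq m] (N : OpMap m n) :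
    Matrix (m × n) (m × n) ℂ :=
  ∑ i, ∑ j, Matrix.single i j (1 : ℂ) ⊗ₖ N (Matrix.single i j 1)

/-- Completely positive-Wigner-preserving maps `A → B`. -/
def IsCPWP (A B : QSystem) (N : OpMap A.Basis B.Basis) : Prop :=
  IsHermiticityPreserving N ∧
    ∀ (R : QSystem), ∀ ρ ∈ (R.tensor A).wignerStates,
      (idTensor R.Basis N ρ : (R.tensor B).Op) ∈ (R.tensor B).wignerStates

/-! ### Superchannels -/

/-- Linear maps taking maps `a → b` to maps `c → d`. -/
abbrev SuperMap (a b c d : Type) : Type := OpMap a b →ₗ[ℂ] OpMap c d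

/-- The `(r, r', s, s')` block of a map `N : RA → RB`, that is the map
`X ↦ ⟨s| N(|r⟩⟨r'| ⊗ X) |s'⟩` from operators on `A` to operators on `B`. -/
def refBlock {r a b : Type} [DecidableEq r] (N : OpMap (r × a) (r × b)) (i i' s s' : r) :
    OpMap a b where
  toFun X := Matrix.of fun k l => N (Matrix.single i i' (1 : ℂ) ⊗ₖ X) (s, k) (s', l)
  map_add' X Y := by
    ext k l
    simp [Matrix.kronecker_add]
  map_smul' c X := by
    ext k l
    simp [Matrix.kronecker_smul]

/-- The map `id_R ⊗ Ξ` (`id_R` the identity supermap on `R → R`), applied to `N : RA → RB`: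
writing `N = ∑ (|r⟩⟨r'| ↦ |s⟩⟨s'|) ⊗ N_{rr'ss'}` with the blocks above, every block
`N_{rr'ss'}` is replaced by `Ξ(N_{rr'ss'})`. -/
def idTensorSuper (r : Type) [Fintype r] [DecidableEq r] {a b c d : Type}
    (Ξ : SuperMap a b c d) (N : OpMap (r × a) (r × b)) : OpMap (r × c) (r × d) where
  toFun Z := Matrix.of fun p q => ∑ i, ∑ i',
    Ξ (refBlock N i i' p.1 q.1) (Matrix.of fun k l => Z (i, k) (i', l)) p.2 q.2
  map_add' Z Z' := by
    ext p q
    simp only [Matrix.of_apply, Matrix.add_apply, ← Finset.sum_add_distrib]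
    refine Finset.sum_congr rfl fun i _ => Finset.sum_congr rfl fun i' _ => ?_
    exact congrFun (congrFun ((Ξ (refBlock N i i' p.1 q.1)).map_add
      (Matrix.of fun k l => Z (i, k) (i', l)) (Matrix.of fun k l => Z' (i, k) (i', l))) p.2) q.2
  map_smul' t Z := by
    ext p q
    simp only [Matrix.of_apply, Matrix.smul_apply, Finset.smul_sum, RingHom.id_apply]
    refine Finset.sum_congr rfl fun i _ => Finset.sum_congr rfl fun i' _ => ?_
    exact congrFun (congrFun ((Ξ (refBlock N i i' p.1 q.1)).map_smul t
      (Matrix.of fun k l => Z (i, k) (i', l))) p.2) q.2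

/-- A superchannel: `(id_R ⊗ Ξ)(N)` is a channel `RC → RD` for every channel `N : RA → RB` and
every (finite-dimensional) reference system `R`. -/
def IsSuperchannel {a b c d : Type} [Fintype a] [Fintype b] [Fintype c] [Fintype d]
    (Ξ : SuperMap a b c d) : Prop :=
  ∀ (r : Type) [Fintype r] [DecidableEq r] (N : OpMap (r × a) (r × b)),
    IsChannel N → IsChannel (idTensorSuper r Ξ N)

/-- The map `X ↦ ⟨k| X |k'⟩ • |l⟩⟨l'|`. -/
def unitMap {a b : Type} [DecidableEq b] (k k' : a) (l l' : b) : OpMap a b where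
  toFun X := X k k' • Matrix.single l l' (1 : ℂ)
  map_add' X Y := by simp [add_smul]
  map_smul' c X := by simp [mul_smul]

/-- The bipartite map `P : CB → AD` corresponding to a supermap `Ξ : (A → B) → (C → D)`:
`⟨k, s| P(|i⟩⟨i'| ⊗ |l⟩⟨l'|) |k', s'⟩ = ⟨s| Ξ(X ↦ ⟨k|X|k'⟩ |l⟩⟨l'|)(|i⟩⟨i'|) |s'⟩`.
When `Ξ(N) = 𝒟 ∘ N ∘ ℰ` with `ℰ : C → AM`, `𝒟 : BM → D`, this is `𝒟 ∘ ℰ`;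
see `bipartiteMap_of_realization`. -/
def bipartiteMap {a b c d : Type} [Fintype b] [DecidableEq b] [Fintype c] [DecidableEq c]
    (Ξ : SuperMap a b c d) : OpMap (c × b) (a × d) where
  toFun Z := Matrix.of fun p q => ∑ x : c × b, ∑ y : c × b,
    Z x y * Ξ (unitMap p.1 q.1 x.2 y.2) (Matrix.single x.1 y.1 1) p.2 q.2
  map_add' Z Z' := by
    ext p q
    simp [add_mul, Finset.sum_add_distrib]
  map_smul' t Z := by
    ext p q
    simp [Finset.mul_sum, mul_assoc]

/-- If `Ξ(N) = 𝒟 ∘ (id_M ⊗ N) ∘ ℰ` for all `N`, then the bipartite map of `Ξ` is `𝒟 ∘ ℰ`: it sends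
`W_C ⊗ Y_B` to the operator on `AD` whose `(k, k')` block is `𝒟(⟨k|ℰ(W)|k'⟩ ⊗ Y)`. -/
theorem bipartiteMap_of_realization {a b c d m : Type} [Fintype b] [DecidableEq b]
    [Fintype c] [DecidableEq c] (Ξ : SuperMap a b c d)
    (E : OpMap c (m × a)) (D : OpMap (m × b) d)
    (h : ∀ N, Ξ N = D ∘ₗ idTensor m N ∘ₗ E)
    (W : Matrix c c ℂ) (Y : Matrix b b ℂ) (k k' : a) (s s' : d) :
    bipartiteMap Ξ (W ⊗ₖ Y) (k, s) (k', s') =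
      D ((Matrix.of fun x y => E W (x, k) (y, k')) ⊗ₖ Y) s s' := by
  have key : ((Matrix.of fun x y => E W (x, k) (y, k')) ⊗ₖ Y : Matrix (m × b) (m × b) ℂ) =
      ∑ x : c × b, ∑ y : c × b, (W x.1 y.1 * Y x.2 y.2) •
        idTensor m (unitMap k k' x.2 y.2) (E (Matrix.single x.1 y.1 1)) := by
    have hE : ∀ p q, E W p q = ∑ i, ∑ j, W i j * E (Matrix.single i j 1) p q := by
      intro p q
      conv_lhs => rw [Matrix.matrix_eq_sum_single W]
      simp only [map_sum, Matrix.sum_apply]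
      refine Finset.sum_congr rfl fun i _ => Finset.sum_congr rfl fun j _ => ?_
      rw [← mul_one (W i j), ← smul_eq_mul (W i j) 1, ← Matrix.smul_single, map_smul]
      simp
    ext ⟨p, t⟩ ⟨q, t'⟩
    simp only [Matrix.kroneckerMap_apply, Matrix.of_apply, Matrix.sum_apply, Matrix.smul_apply,
      hE, Fintype.sum_prod_type, idTensor, unitMap, LinearMap.coe_mk, AddHom.coe_mk, smul_eq_mul,
      Matrix.single_apply, Finset.sum_mul]
    refine Finset.sum_congr rfl fun i _ => ?_
    rw [Finset.sum_comm]
    refine Finset.sum_congr rfl fun j _ => ?_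
    simp [ite_and, mul_right_comm, mul_assoc]
  rw [key]
  simp [bipartiteMap, h, map_sum, Matrix.sum_apply]

/-- The discrete Wigner function of a superchannel,
`W_Ξ(u_A, v_D | u_C, v_B) = 1/(d_A d_D) Tr[(A_{u_A} ⊗ A_{v_D}) P(A_{u_C} ⊗ A_{v_B})]`. -/
def superWigner {A B C D : QSystem} (Ξ : SuperMap A.Basis B.Basis C.Basis D.Basis)
    (uA : A.Phase) (vD : D.Phase) (uC : C.Phase) (vB : B.Phase) : ℂ :=
  (1 / ((A.dim : ℂ) * (D.dim : ℂ))) *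
    ((A.phasePoint uA ⊗ₖ D.phasePoint vD) *
      bipartiteMap Ξ (C.phasePoint uC ⊗ₖ B.phasePoint vB)).trace

/-- CPWP superchannels: `(id_R ⊗ Ξ)(N)` is CPWP for all CPWP channels `N : RA → RB` and
all reference systems `R`. -/
def IsCPWPSuper {A B C D : QSystem} (Ξ : SuperMap A.Basis B.Basis C.Basis D.Basis) : Prop :=
  ∀ (R : QSystem) (N : OpMap (R.tensor A).Basis (R.tensor B).Basis),
    IsChannel N → IsCPWP (R.tensor A) (R.tensor B) N →
      IsCPWP (R.tensor C) (R.tensor D) (idTensorSuper R.Basis Ξ N)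

/-- A classical bipartite channel `p(x, y | z, w)` (non-negative, normalised) whose output `x`
cannot be signalled to from the input `w`: the marginal `∑_y p(x, y | z, w)` does not depend
on `w`. -/
def IsNonsignallingChannel {X Y Z W : Type} [Fintype X] [Fintype Y]
    (p : X → Y → Z → W → ℂ) : Prop :=
  (∀ x y z w, 0 ≤ p x y z w) ∧ (∀ z w, ∑ x, ∑ y, p x y z w = 1) ∧
    ∀ x z w w', ∑ y, p x y z w = ∑ y, p x y z w'

end

/-! The phase-space point operators `A_u` are orthogonal of squared norm `d`, so `V = ∑_u W_V(u)
A_u` and a map `N` acts on Wigner functions through the kernel `W_N(v|u) = W_{N(A_u)}(v)`. A channel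
is CPWP exactly when this kernel is non-negative: non-negativity passes to `id_R ⊗ N`, and
conversely the kernel is read off the image of the maximally entangled state, whose Wigner function
is non-negative because transposition permutes the `A_u`.

The same expansion, applied to the maps `X ↦ Tr[A_u X] A_v`, shows that `id_R ⊗ Ξ` acts on kernels
by `W_N ↦ ∑_{u_A, v_B} W_Ξ(u_A, v_D | u_C, v_B) W_N(v_B | u_A)`, with the arguments on `R` carried
along. Hence `W_Ξ ≥ 0` makes `Ξ` CPWP, and applying `id_R ⊗ Ξ` with `R = AB` to a CPWP channel that
exchanges `A` and `B` with the reference isolates a single value of `W_Ξ`. Up to transposition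
and a positive factor `W_Ξ` is also the Wigner function of the Choi operator.

Normalisation and non-signalling hold for every superchannel. A Hermiticity-preserving map that
annihilates the trace is a multiple of the difference between a channel and the completely
depolarizing channel; since `Ξ` maps channels to channels, it maps trace-annihilating maps to
trace-annihilating maps, and so trace-preserving maps to trace-preserving ones. -/

noncomputable section

namespace QSystem

/-! ### Phase-space point operators of a qudit -/

section Qudit

variable {d : ℕ}

theorem isUnit_two (ho : Odd d) : IsUnit (2 : ZMod d) := by
  exact_mod_cast (ZMod.isUnit_iff_coprime 2 d).2 ho.coprime_two_left

theorem inv_two_mul_two (ho : Odd d) : (2⁻¹ : ZMod d) * 2 = 1 :=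
  ZMod.inv_mul_of_unit _ (isUnit_two ho)

theorem dim_qudit (hp : d.Prime) (ho : Odd d) : (qudit d hp ho).dim = d := by
  have : NeZero d := ⟨hp.ne_zero⟩
  exact ZMod.card d

variable [NeZero d]

theorem omega_pow_val (a : ZMod d) :
    Complex.exp (2 * Real.pi * Complex.I / d) ^ a.val = ZMod.stdAddChar a := by
  rw [ZMod.stdAddChar_apply, ZMod.toCircle_apply, ← Complex.exp_nat_mul]
  congr 1
  ring

/- For odd `d`, `τ = e^{(d+1)πi/d}` is the square root `ω^{(d+1)/2}` of `ω = e^{2πi/d}` among the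
powers of `ω`, and `(d+1)/2` is the inverse of `2` modulo `d`. -/
theorem tau_zpow (ho : Odd d) (n : ℤ) :
    Complex.exp ((d + 1) * Real.pi * Complex.I / d) ^ n = ZMod.stdAddChar ((n : ZMod d) * 2⁻¹) := by
  obtain ⟨k, hk⟩ := id ho
  have inv_two : (2⁻¹ : ZMod d) = k + 1 := by
    have cast_d : (2 * k + 1 : ZMod d) = 0 := by
      rw [← ZMod.natCast_self d, hk, Nat.cast_add, Nat.cast_mul, Nat.cast_ofNat, Nat.cast_one]
    linear_combination (k + 1) * inv_two_mul_two ho - 2⁻¹ * cast_d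
  have cast_d : (d : ℂ) = 2 * k + 1 := by exact_mod_cast hk
  rw [inv_two, show (n : ZMod d) * (k + 1) = ((n * (k + 1) : ℤ) : ZMod d) by push_cast; ring,
    ZMod.stdAddChar_coe, ← Complex.exp_int_mul]
  congr 1
  push_cast
  rw [show (d : ℂ) + 1 = 2 * (k + 1) by rw [cast_d]; ring]
  ring

theorem sum_stdAddChar_mul (b : ZMod d) :
    ∑ x : ZMod d, (ZMod.stdAddChar (x * b) : ℂ) = if b = 0 then (d : ℂ) else 0 := by
  simpa [ZMod.card] using AddChar.sum_mulShift b (ZMod.isPrimitive_stdAddChar d)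

theorem shiftX_pow_apply (n : ℕ) (j k : ZMod d) :
    (shiftX d ^ n) j k = if j = k + n then 1 else 0 := by
  induction n generalizing j k with
  | zero => simp [Matrix.one_apply]
  | succ n ih =>
    have shiftX_apply : ∀ m, shiftX d m k = if m = k + 1 then 1 else 0 := fun _ => rfl
    rw [pow_succ, Matrix.mul_apply]
    simp [ih, shiftX_apply, add_assoc, add_comm (1 : ZMod d)]

variable (hp : d.Prime) (ho : Odd d) (u : ZMod d × ZMod d) (j k : ZMod d)

theorem weyl_qudit_apply :
    (qudit d hp ho).weyl u j k =
      if j = k + u.2 then ZMod.stdAddChar (u.1 * j - u.1 * u.2 * 2⁻¹) else 0 := by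
  have weyl_eq : (qudit d hp ho).weyl u =
      (Complex.exp ((d + 1) * Real.pi * Complex.I / d) ^ (-((u.1.val * u.2.val : ℕ) : ℤ))) •
        (boostZ d ^ u.1.val * shiftX d ^ u.2.val) := rfl
  rw [weyl_eq, tau_zpow ho, boostZ, Matrix.diagonal_pow, Matrix.smul_apply, Matrix.diagonal_mul,
    shiftX_pow_apply]
  simp only [Pi.pow_apply, smul_eq_mul, ZMod.natCast_zmod_val, mul_ite, mul_one, mul_zero]
  congr 1
  rw [omega_pow_val, ← AddChar.map_nsmul_eq_pow, ← AddChar.map_add_eq_mul]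
  congr 1
  simp only [Int.cast_neg, Int.cast_mul, Int.cast_natCast, Nat.cast_mul, ZMod.natCast_zmod_val,
    nsmul_eq_mul]
  ring

theorem phasePointZero_qudit_apply :
    (qudit d hp ho).phasePointZero j k = if j + k = 0 then 1 else 0 := by
  have expand : (qudit d hp ho).phasePointZero j k =
      (1 / (d : ℂ)) * ∑ u : ZMod d × ZMod d, (qudit d hp ho).weyl u j k := by
    rw [phasePointZero, dim_qudit, Matrix.smul_apply, Matrix.sum_apply, smul_eq_mul]
  have weyl_apply : ∀ x y : ZMod d, (qudit d hp ho).weyl (x, y) j k =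
      if y = j - k then ZMod.stdAddChar (x * ((j + k) * 2⁻¹)) else 0 := by
    intro x y
    rw [weyl_qudit_apply]
    refine ite_congr (propext (by rw [eq_sub_iff_add_eq', eq_comm])) (fun hy => ?_) fun _ => rfl
    congr 1
    linear_combination (-x * j) * inv_two_mul_two ho - x * 2⁻¹ * hy
  have half_eq_zero : (j + k) * 2⁻¹ = 0 ↔ j + k = 0 :=
    ⟨fun h => by linear_combination 2 * h - (j + k) * inv_two_mul_two ho, fun h => by simp [h]⟩
  have hd : (d : ℂ) ≠ 0 := NeZero.ne _
  rw [expand, Fintype.sum_prod_type]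
  simp only [weyl_apply, Finset.sum_ite_eq', Finset.mem_univ, if_true, sum_stdAddChar_mul,
    half_eq_zero]
  split_ifs <;> simp [hd]

theorem phasePoint_qudit_apply :
    (qudit d hp ho).phasePoint u j k =
      if j + k = 2 * u.2 then ZMod.stdAddChar (u.1 * (j - k)) else 0 := by
  have expand : (qudit d hp ho).phasePoint u j k = ∑ n : ZMod d, (∑ m : ZMod d,
      (qudit d hp ho).weyl u j m * (qudit d hp ho).phasePointZero m n) *
        star ((qudit d hp ho).weyl u k n) := by
    rw [phasePoint, Matrix.mul_apply]
    simp only [Matrix.mul_apply, Matrix.conjTranspose_apply]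
  rw [expand, Finset.sum_eq_single (k - u.2), Finset.sum_eq_single (j - u.2)]
  · have parity : j - u.2 + (k - u.2) = 0 ↔ j + k = 2 * u.2 :=
      ⟨fun h => by linear_combination h, fun h => by linear_combination h⟩
    simp only [weyl_qudit_apply, phasePointZero_qudit_apply, sub_add_cancel, if_true, parity]
    split_ifs
    · rw [mul_one, ← starRingEnd_apply, ← AddChar.map_neg_eq_conj, ← AddChar.map_add_eq_mul]
      congr 1
      ring
    · rw [mul_zero, zero_mul]
  · intro m _ hm
    rw [weyl_qudit_apply, if_neg (fun h => hm (by rw [h]; ring)), zero_mul]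
  · simp
  · intro n _ hn
    rw [weyl_qudit_apply, if_neg (c := k = n + u.2) (fun h => hn (by rw [h]; ring)), star_zero,
      mul_zero]
  · simp

theorem trace_phasePoint_qudit : ((qudit d hp ho).phasePoint u).trace = 1 := by
  have expand : ((qudit d hp ho).phasePoint u).trace =
      ∑ j : ZMod d, (qudit d hp ho).phasePoint u j j := rfl
  simp only [expand, phasePoint_qudit_apply, ← two_mul, (isUnit_two ho).mul_right_inj, sub_self,
    mul_zero, AddChar.map_zero_eq_one, Finset.sum_ite_eq', Finset.mem_univ, if_true]

theorem trace_phasePoint_mul_qudit (v : ZMod d × ZMod d) :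
    ((qudit d hp ho).phasePoint u * (qudit d hp ho).phasePoint v).trace =
      if u = v then (d : ℂ) else 0 := by
  have expand : ((qudit d hp ho).phasePoint u * (qudit d hp ho).phasePoint v).trace =
      ∑ j : ZMod d, ∑ k : ZMod d,
        (qudit d hp ho).phasePoint u j k * (qudit d hp ho).phasePoint v k j := rfl
  have row_sum : ∀ j : ZMod d, ∑ k : ZMod d,
      (qudit d hp ho).phasePoint u j k * (qudit d hp ho).phasePoint v k j =
        if u.2 = v.2 then ZMod.stdAddChar ((2 * j - 2 * u.2) * (u.1 - v.1)) else 0 := by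
    intro j
    rw [Finset.sum_eq_single (2 * u.2 - j)]
    · rw [phasePoint_qudit_apply, phasePoint_qudit_apply, if_pos (by ring), sub_add_cancel,
        mul_ite, mul_zero, ← AddChar.map_add_eq_mul]
      refine ite_congr (propext (isUnit_two ho).mul_right_inj) (fun _ => ?_) fun _ => rfl
      congr 1
      ring
    · intro k _ hk
      rw [phasePoint_qudit_apply, if_neg (fun h => hk (by linear_combination h)), zero_mul]
    · simp
  have reindex : ∑ j : ZMod d, (ZMod.stdAddChar ((2 * j - 2 * u.2) * (u.1 - v.1)) : ℂ) =
      ∑ x : ZMod d, ZMod.stdAddChar (x * (u.1 - v.1)) :=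
    Fintype.sum_bijective (fun j : ZMod d => 2 * j - 2 * u.2)
      (Finite.injective_iff_bijective.1 fun _ _ h =>
        (isUnit_two ho).mul_right_injective (sub_left_injective h)) _ _ fun _ => rfl
  rw [expand, Finset.sum_congr rfl fun j _ => row_sum j]
  by_cases h : u.2 = v.2
  · simp only [if_pos h, reindex, sum_stdAddChar_mul, sub_eq_zero]
    simp only [Prod.ext_iff, h, and_true]
  · simp [h, Prod.ext_iff]

end Qudit

/-! ### Phase-space point operators of composite systems -/

instance instNonemptyBasis : (S : QSystem) → Nonempty S.Basis
  | trivial => ⟨()⟩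
  | qudit d _ _ => ⟨(0 : ZMod d)⟩
  | tensor A B =>
    have := instNonemptyBasis A
    have := instNonemptyBasis B
    inferInstanceAs (Nonempty (A.Basis × B.Basis))

instance instDecidableEqPhase (S : QSystem) : DecidableEq S.Phase := Classical.decEq _

theorem dim_ne_zero (S : QSystem) : (S.dim : ℂ) ≠ 0 :=
  Nat.cast_ne_zero.2 (Fintype.card_ne_zero (α := S.Basis))

theorem one_div_dim_pos (S : QSystem) : 0 < 1 / (S.dim : ℂ) :=
  one_div_pos.2 (Nat.cast_pos.2 (Fintype.card_pos (α := S.Basis)))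

theorem dim_tensor (A B : QSystem) : (A.tensor B).dim = A.dim * B.dim := Fintype.card_prod _ _

theorem card_phase : (S : QSystem) → Fintype.card S.Phase = S.dim ^ 2
  | trivial => rfl
  | qudit d hp ho => by
    have : NeZero d := ⟨hp.ne_zero⟩
    rw [dim_qudit, sq]
    exact (Fintype.card_prod _ _).trans (by rw [ZMod.card])
  | tensor A B => by
    rw [dim_tensor, mul_pow, ← card_phase A, ← card_phase B]
    exact Fintype.card_prod _ _

theorem phasePointZero_tensor (A B : QSystem) :
    (A.tensor B).phasePointZero = A.phasePointZero ⊗ₖ B.phasePointZero := by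
  have expand : (A.tensor B).phasePointZero =
      (1 / ((A.dim * B.dim : ℕ) : ℂ)) • ∑ u : A.Phase × B.Phase, A.weyl u.1 ⊗ₖ B.weyl u.2 := by
    rw [← dim_tensor]
    rfl
  rw [expand, phasePointZero, phasePointZero, Matrix.smul_kronecker, Matrix.kronecker_smul,
    smul_smul, Nat.cast_mul, one_div_mul_one_div, Fintype.sum_prod_type]
  ext p q
  simp [Matrix.sum_apply, Finset.sum_mul_sum]

theorem phasePoint_tensor (A B : QSystem) (u : A.Phase) (v : B.Phase) :
    (A.tensor B).phasePoint (u, v) = A.phasePoint u ⊗ₖ B.phasePoint v := by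
  have weyl_tensor : (A.tensor B).weyl (u, v) = A.weyl u ⊗ₖ B.weyl v := rfl
  rw [phasePoint, phasePointZero_tensor, weyl_tensor]
  simp only [phasePoint, Matrix.mul_kronecker_mul, ← Matrix.conjTranspose_kronecker]

theorem phasePoint_trivial (u : trivial.Phase) : trivial.phasePoint u = 1 := by
  have weyl_eq_one : ∀ u, trivial.weyl u = 1 := fun _ => rfl
  simp [phasePoint, phasePointZero, weyl_eq_one, dim]

theorem trace_phasePoint : (S : QSystem) → (u : S.Phase) → (S.phasePoint u).trace = 1
  | trivial, u => by simp [phasePoint_trivial]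
  | qudit d hp ho, u => by
    have : NeZero d := ⟨hp.ne_zero⟩
    exact trace_phasePoint_qudit hp ho u
  | tensor A B, (u, v) => by
    rw [phasePoint_tensor]
    exact (Matrix.trace_kronecker _ _).trans
      (by rw [trace_phasePoint A, trace_phasePoint B, one_mul])

theorem trace_phasePoint_mul : (S : QSystem) → (u v : S.Phase) →
    (S.phasePoint u * S.phasePoint v).trace = if u = v then (S.dim : ℂ) else 0
  | trivial, u, v => by
    rw [phasePoint_trivial, mul_one, Matrix.trace_one, if_pos rfl, dim]
  | qudit d hp ho, u, v => by
    have : NeZero d := ⟨hp.ne_zero⟩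
    rw [dim_qudit]
    exact (trace_phasePoint_mul_qudit hp ho u v).trans (by congr)
  | tensor A B, (u, v), (u', v') => by
    have factor : ((A.tensor B).phasePoint (u, v) * (A.tensor B).phasePoint (u', v')).trace =
        (A.phasePoint u * A.phasePoint u').trace * (B.phasePoint v * B.phasePoint v').trace := by
      rw [← Matrix.trace_kronecker, Matrix.mul_kronecker_mul, phasePoint_tensor, phasePoint_tensor]
    rw [factor, trace_phasePoint_mul A, trace_phasePoint_mul B, dim_tensor, Nat.cast_mul]
    by_cases hu : u = u' <;> by_cases hv : v = v' <;> simp [hu, hv]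

/-- The action of transposition in the computational basis on phase space: it flips the sign of
the first (boost) coordinate of each qudit. -/
def reflect : (S : QSystem) → S.Phase → S.Phase
  | trivial, u => u
  | qudit _ _ _, u => (-u.1, u.2)
  | tensor A B, u => (reflect A u.1, reflect B u.2)

theorem phasePoint_reflect : (S : QSystem) → (u : S.Phase) →
    S.phasePoint (S.reflect u) = (S.phasePoint u)ᵀ
  | trivial, u => by rw [phasePoint_trivial, Matrix.transpose_one]
  | qudit d hp ho, u => by
    have : NeZero d := ⟨hp.ne_zero⟩
    ext j k
    rw [reflect, Matrix.transpose_apply, phasePoint_qudit_apply, phasePoint_qudit_apply,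
      add_comm j k, ← neg_sub k j, neg_mul_neg]
  | tensor A B, (u, v) => by
    rw [phasePoint_tensor, reflect, phasePoint_tensor, phasePoint_reflect A, phasePoint_reflect B]
    rfl

theorem reflect_reflect : (S : QSystem) → (u : S.Phase) → S.reflect (S.reflect u) = u
  | trivial, _ => rfl
  | qudit _ _ _, u => by simp only [reflect, neg_neg]
  | tensor A B, u => by simp only [reflect, reflect_reflect A, reflect_reflect B]

/-! ### Discrete Wigner functions of operators -/

variable (S : QSystem)

theorem wigner_smul (c : ℂ) (V : S.Op) (u : S.Phase) : S.wigner (c • V) u = c * S.wigner V u := by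
  rw [wigner, wigner, Matrix.mul_smul, Matrix.trace_smul, smul_eq_mul, mul_left_comm]

theorem wigner_sum {ι : Type} (s : Finset ι) (V : ι → S.Op) (u : S.Phase) :
    S.wigner (∑ i ∈ s, V i) u = ∑ i ∈ s, S.wigner (V i) u := by
  simp only [wigner, Matrix.trace_sum, Finset.mul_sum]

theorem wigner_phasePoint (v u : S.Phase) :
    S.wigner (S.phasePoint v) u = if v = u then 1 else 0 := by
  rw [wigner, trace_phasePoint_mul, mul_ite, one_div_mul_cancel S.dim_ne_zero, mul_zero]
  simp only [eq_comm]

theorem linearIndependent_phasePoint : LinearIndependent ℂ S.phasePoint := by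
  refine Fintype.linearIndependent_iff.2 fun c hc u => ?_
  have hu : S.wigner (∑ v, c v • S.phasePoint v) u = c u := by
    simp [wigner_sum, wigner_smul, wigner_phasePoint]
  rw [← hu, hc, wigner, Matrix.mul_zero, Matrix.trace_zero, mul_zero]

/- There are `dim²` phase-space points, so the independent operators `A_u` form a basis. -/
theorem sum_wigner_smul_phasePoint (V : S.Op) : ∑ u, S.wigner V u • S.phasePoint u = V := by
  have span_eq_top := S.linearIndependent_phasePoint.span_eq_top_of_card_eq_finrank'
    (by rw [card_phase, Module.finrank_matrix, Module.finrank_self, mul_one, ← sq, dim])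
  obtain ⟨c, rfl⟩ := (Submodule.mem_span_range_iff_exists_fun ℂ).1
    (span_eq_top ▸ Submodule.mem_top : V ∈ Submodule.span ℂ (Set.range S.phasePoint))
  simp [wigner_sum, wigner_smul, wigner_phasePoint]

theorem sum_wigner (V : S.Op) : ∑ u, S.wigner V u = V.trace := by
  conv_rhs => rw [← S.sum_wigner_smul_phasePoint V]
  simp [Matrix.trace_sum, trace_phasePoint]

theorem wigner_one (u : S.Phase) : S.wigner 1 u = 1 / (S.dim : ℂ) := by
  rw [wigner, mul_one, trace_phasePoint, mul_one]

theorem sum_phasePoint : ∑ u, S.phasePoint u = (S.dim : ℂ) • 1 := by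
  conv_rhs => rw [← S.sum_wigner_smul_phasePoint 1]
  simp [wigner_one, ← Finset.smul_sum, smul_smul, S.dim_ne_zero]

end QSystem

/-! ### Contractions of maps between operator spaces -/

section Contraction

variable {r a b : Type}

theorem idTensor_kronecker (N : OpMap a b) (G : Matrix r r ℂ) (X : Matrix a a ℂ) :
    idTensor r N (G ⊗ₖ X) = G ⊗ₖ N X := by
  ext p q
  exact congrFun (congrFun (N.map_smul (G p.1 q.1) X) p.2) q.2

theorem opMap_apply_eq_sum_single [Fintype a] [DecidableEq a] (N : OpMap a b) (X : Matrix a a ℂ) :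
    N X = ∑ i, ∑ j, X i j • N (Matrix.single i j 1) := by
  conv_lhs => rw [Matrix.matrix_eq_sum_single X]
  simp only [map_sum, ← map_smul, Matrix.smul_single, smul_eq_mul, mul_one]

theorem choi_apply [Fintype a] [DecidableEq a] (N : OpMap a b) (p q : a × b) :
    choi N p q = N (Matrix.single p.1 q.1 1) p.2 q.2 := by
  simp [choi, Matrix.sum_apply, Matrix.single_apply, ite_and]

/-- The measure-and-prepare map `X ↦ Tr[F X] Y`. -/
def measPrep [Fintype a] (F : Matrix a a ℂ) (Y : Matrix b b ℂ) : OpMap a b :=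
  (Matrix.traceLinearMap a ℂ ℂ ∘ₗ LinearMap.mulLeft ℂ F).smulRight Y

theorem measPrep_apply [Fintype a] (F : Matrix a a ℂ) (Y : Matrix b b ℂ) (X : Matrix a a ℂ) :
    measPrep F Y X = (F * X).trace • Y := rfl

theorem measPrep_single [Fintype a] [DecidableEq a] [Fintype b] [DecidableEq b] (p q : a)
    (Y : Matrix b b ℂ) :
    measPrep (Matrix.single p q 1) Y = ∑ l, ∑ l', Y l l' • unitMap q p l l' := by
  ext X : 1
  rw [measPrep_apply, Matrix.trace_single_mul, one_smul]
  conv_lhs => rw [Matrix.matrix_eq_sum_single Y]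
  simp [unitMap, Finset.smul_sum, mul_comm]

theorem measPrep_eq_sum [Fintype a] [DecidableEq a] (F : Matrix a a ℂ) (Y : Matrix b b ℂ) :
    measPrep F Y = ∑ p, ∑ q, F p q • measPrep (Matrix.single p q 1) Y := by
  ext X : 1
  conv_lhs => rw [Matrix.matrix_eq_sum_single F]
  simp only [measPrep_apply, LinearMap.sum_apply, LinearMap.smul_apply, Matrix.sum_mul,
    Matrix.trace_sum, Finset.sum_smul, Matrix.trace_single_mul, smul_smul, smul_eq_mul, one_mul]

variable [Fintype r]

/-- The partial contraction `X ↦ Tr_R[(F ⊗ 1) X]`; for `F = 1` it is the partial trace. -/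
def partialContract (F : Matrix r r ℂ) : OpMap (r × a) a where
  toFun X := ∑ p, ∑ q, F p q • X.submatrix (Prod.mk q) (Prod.mk p)
  map_add' X Y := by simp [Matrix.submatrix_add, Finset.sum_add_distrib]
  map_smul' c X := by simp [Matrix.submatrix_smul, Finset.smul_sum, smul_comm c]

theorem partialContract_apply (F : Matrix r r ℂ) (X : Matrix (r × a) (r × a) ℂ) :
    partialContract F X = ∑ p, ∑ q, F p q • X.submatrix (Prod.mk q) (Prod.mk p) := rfl

theorem trace_kronecker_mul [Fintype a] (F : Matrix r r ℂ) (G : Matrix a a ℂ)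
    (X : Matrix (r × a) (r × a) ℂ) :
    ((F ⊗ₖ G) * X).trace = (G * partialContract F X).trace := by
  simp only [partialContract_apply, Matrix.mul_sum, Matrix.mul_smul, Matrix.trace_sum,
    Matrix.trace_smul]
  simp only [Matrix.trace, Matrix.diag_apply, Matrix.mul_apply, Matrix.submatrix_apply,
    Fintype.sum_prod_type, Matrix.kroneckerMap_apply, smul_eq_mul, Finset.mul_sum, mul_assoc]
  exact Finset.sum_congr rfl fun _ _ => Finset.sum_comm

theorem trace_partialContract_one [DecidableEq r] [Fintype a] (X : Matrix (r × a) (r × a) ℂ) :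
    (partialContract 1 X).trace = X.trace := by
  classical
  rw [← one_mul (partialContract 1 X), ← trace_kronecker_mul, Matrix.one_kronecker_one, one_mul]

theorem partialContract_kronecker (F G : Matrix r r ℂ) (Y : Matrix a a ℂ) :
    partialContract F (G ⊗ₖ Y) = (F * G).trace • Y := by
  ext i j
  simp [partialContract_apply, Matrix.sum_apply, Matrix.trace, Matrix.mul_apply, Finset.sum_mul,
    mul_assoc]

theorem partialContract_idTensor (F : Matrix r r ℂ) (N : OpMap a b)
    (X : Matrix (r × a) (r × a) ℂ) :
    partialContract F (idTensor r N X) = N (partialContract F X) := by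
  simp only [partialContract_apply, map_sum, map_smul]
  rfl

theorem partialContract_choi [DecidableEq r] (N : OpMap r b) (F : Matrix r r ℂ) :
    partialContract F (choi N) = N Fᵀ := by
  rw [opMap_apply_eq_sum_single N Fᵀ]
  simp only [choi, map_sum, partialContract_kronecker, Matrix.trace_mul_single,
    Matrix.transpose_apply, MulOpposite.op_one, one_smul]

/-- The map `X ↦ Tr_R[(F ⊗ 1) N(G ⊗ X)]` obtained from `N : RA → RB` by preparing `G` at the input
of `R` and contracting the output of `R` with `F`. -/
def contractMap (F G : Matrix r r ℂ) (N : OpMap (r × a) (r × b)) : OpMap a b :=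
  partialContract F ∘ₗ N ∘ₗ Matrix.kroneckerBilinear (R := ℂ) G

theorem contractMap_apply (F G : Matrix r r ℂ) (N : OpMap (r × a) (r × b)) (X : Matrix a a ℂ) :
    contractMap F G N X = partialContract F (N (G ⊗ₖ X)) := rfl

theorem contractMap_eq_sum [DecidableEq r] (F G : Matrix r r ℂ) (N : OpMap (r × a) (r × b)) :
    contractMap F G N = ∑ p, ∑ q, ∑ i, ∑ i', (F p q * G i i') • refBlock N i i' q p := by
  ext X k l
  have expand : G ⊗ₖ X = ∑ i, ∑ i', G i i' • (Matrix.single i i' (1 : ℂ) ⊗ₖ X) := by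
    ext p q
    simp [Matrix.sum_apply, Matrix.single_apply, ite_and]
  rw [contractMap_apply, partialContract_apply, expand]
  simp only [map_sum, map_smul, LinearMap.sum_apply, LinearMap.smul_apply, Matrix.sum_apply,
    Matrix.smul_apply, Matrix.submatrix_apply, refBlock, LinearMap.coe_mk, AddHom.coe_mk,
    Matrix.of_apply, smul_eq_mul, Finset.mul_sum, mul_assoc]

end Contraction

/-! ### Contractions of supermaps -/

section SuperContraction

variable {r a b c d : Type} (Ξ : SuperMap a b c d)

theorem partialContract_idTensorSuper [Fintype r] [DecidableEq r] (N : OpMap (r × a) (r × b))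
    (F G : Matrix r r ℂ) (V : Matrix c c ℂ) :
    partialContract F (idTensorSuper r Ξ N (G ⊗ₖ V)) = Ξ (contractMap F G N) V := by
  have block : ∀ i i', (Matrix.of fun k l => (G ⊗ₖ V) (i, k) (i', l)) = G i i' • V := fun _ _ => rfl
  ext k l
  simp only [contractMap_eq_sum, partialContract_apply, idTensorSuper, LinearMap.coe_mk,
    AddHom.coe_mk, block, map_sum, map_smul, LinearMap.sum_apply, LinearMap.smul_apply,
    Matrix.sum_apply, Matrix.smul_apply, Matrix.submatrix_apply, Matrix.of_apply, smul_eq_mul,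
    Finset.mul_sum, mul_assoc]

variable [Fintype a] [Fintype b] [DecidableEq b] [Fintype c] [DecidableEq c]

theorem bipartiteMap_kronecker_submatrix [DecidableEq a] (V : Matrix c c ℂ) (Y : Matrix b b ℂ)
    (p q : a) :
    (bipartiteMap Ξ (V ⊗ₖ Y)).submatrix (Prod.mk q) (Prod.mk p) =
      Ξ (measPrep (Matrix.single p q 1) Y) V := by
  ext s s'
  rw [opMap_apply_eq_sum_single _ V, measPrep_single]
  simp only [bipartiteMap, LinearMap.coe_mk, AddHom.coe_mk, Matrix.submatrix_apply,
    Matrix.of_apply, Fintype.sum_prod_type, Matrix.kroneckerMap_apply, map_sum, map_smul,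
    LinearMap.sum_apply, LinearMap.smul_apply, Matrix.sum_apply, Matrix.smul_apply, smul_eq_mul,
    Finset.mul_sum, mul_assoc]
  exact Finset.sum_congr rfl fun i _ => Finset.sum_comm

theorem partialContract_bipartiteMap (F : Matrix a a ℂ) (V : Matrix c c ℂ) (Y : Matrix b b ℂ) :
    partialContract F (bipartiteMap Ξ (V ⊗ₖ Y)) = Ξ (measPrep F Y) V := by
  classical
  simp only [partialContract_apply, bipartiteMap_kronecker_submatrix, measPrep_eq_sum F Y, map_sum,
    map_smul, LinearMap.sum_apply, LinearMap.smul_apply]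

end SuperContraction

/-! ### Complete positivity and channels -/

section CompletePositivity

variable {r a b c : Type}

open scoped MatrixOrder Matrix.Norms.L2Operator in
theorem exists_posSemidef_add_smul_one {n : Type} [Finite n] [DecidableEq n] {H : Matrix n n ℂ}
    (hH : H.IsHermitian) : ∃ t : ℝ, 0 < t ∧ (H + (t : ℂ) • 1).PosSemidef := by
  cases nonempty_fintype n
  have norm_bound : -algebraMap ℝ (Matrix n n ℂ) ‖H‖ ≤ H :=
    IsSelfAdjoint.neg_algebraMap_norm_le_self hH.isSelfAdjoint
  refine ⟨‖H‖ + 1, by positivity, ?_⟩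
  have decomposition : H + ((‖H‖ + 1 : ℝ) : ℂ) • 1 = H - -algebraMap ℝ (Matrix n n ℂ) ‖H‖ + 1 := by
    rw [Algebra.algebraMap_eq_smul_one, Complex.coe_smul, add_smul, one_smul, sub_neg_eq_add,
      add_assoc]
  rw [decomposition]
  exact (Matrix.le_iff.1 norm_bound).add Matrix.PosSemidef.one

theorem posSemidef_sum_blocks {n : Type} [Fintype a] [Finite n]
    {Y : Matrix (a × n) (a × n) ℂ} (hY : Y.PosSemidef) :
    (∑ i, ∑ j, Y.submatrix (Prod.mk i) (Prod.mk j)).PosSemidef := by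
  classical
  cases nonempty_fintype n
  let S : Matrix n (a × n) ℂ := Matrix.of fun k x => if k = x.2 then 1 else 0
  convert hY.mul_mul_conjTranspose_same S using 1
  ext k l
  simp only [Matrix.sum_apply, Matrix.submatrix_apply, Matrix.mul_apply, S, Matrix.of_apply,
    Matrix.conjTranspose_apply, Fintype.sum_prod_type, apply_ite star, star_one, star_zero,
    mul_ite, mul_one, mul_zero, ite_mul, one_mul, zero_mul, Finset.sum_ite_eq, Finset.mem_univ,
    if_true]
  exact Finset.sum_comm

/- `id_R ⊗ N` applied to `X` is the sum of all blocks, over the input of `N`, of a rearrangement of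
`X ⊗ J^N`. -/
theorem isCompletelyPositive_of_choi [Fintype a] [DecidableEq a] [Finite b] {N : OpMap a b}
    (hN : (choi N).PosSemidef) : IsCompletelyPositive N := by
  intro r _ _ X hX
  classical
  cases nonempty_fintype b
  convert posSemidef_sum_blocks ((hX.kronecker hN).submatrix
    fun x : a × (r × b) => ((x.2.1, x.1), (x.1, x.2.2))) using 1
  ext p q
  simp only [idTensor, LinearMap.coe_mk, AddHom.coe_mk, Matrix.of_apply, Matrix.sum_apply,
    Matrix.submatrix_apply, Matrix.kroneckerMap_apply, choi_apply]
  rw [opMap_apply_eq_sum_single]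
  simp only [Matrix.sum_apply, Matrix.smul_apply, Matrix.of_apply, smul_eq_mul]

namespace IsCompletelyPositive

variable {N : OpMap a b}

theorem posSemidef_apply (hN : IsCompletelyPositive N) {X : Matrix a a ℂ} (hX : X.PosSemidef) :
    (N X).PosSemidef :=
  (hN Unit (X.submatrix Prod.snd Prod.snd) (hX.submatrix _)).submatrix (Prod.mk ())

theorem isHermiticityPreserving [Finite a] (hN : IsCompletelyPositive N) :
    IsHermiticityPreserving N := by
  classical
  intro X hX
  obtain ⟨t, -, ht⟩ := exists_posSemidef_add_smul_one hX
  have image_add := (hN.posSemidef_apply ht).isHermitian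
  have image_one := (hN.posSemidef_apply (Matrix.PosSemidef.one (n := a) (R := ℂ))).isHermitian
  have decomposition : N X = N (X + (t : ℂ) • 1) - (t : ℂ) • N 1 := by simp
  rw [decomposition]
  exact image_add.sub (image_one.smul (Complex.conj_ofReal t))

theorem idTensor [Finite r] (hN : IsCompletelyPositive N) :
    IsCompletelyPositive (idTensor r N) := by
  intro s _ _ X hX
  classical
  cases nonempty_fintype r
  exact (hN (s × r) (X.submatrix (Equiv.prodAssoc s r a) (Equiv.prodAssoc s r a))
    (hX.submatrix _)).submatrix (Equiv.prodAssoc s r b).symm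

end IsCompletelyPositive

namespace IsChannel

variable [Fintype a] [Fintype b]

theorem comp [Fintype c] {M : OpMap b c} {N : OpMap a b} (hM : IsChannel M) (hN : IsChannel N) :
    IsChannel (M ∘ₗ N) :=
  ⟨fun r _ _ X hX => hM.1 r _ (hN.1 r X hX), fun X => (hM.2 _).trans (hN.2 X)⟩

theorem idTensor [Fintype r] {N : OpMap a b} (hN : IsChannel N) : IsChannel (idTensor r N) := by
  classical
  refine ⟨hN.1.idTensor, fun X => ?_⟩
  rw [← trace_partialContract_one, partialContract_idTensor, hN.2, trace_partialContract_one]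

theorem reindex (e : a ≃ b) :
    IsChannel (Matrix.reindexLinearEquiv ℂ ℂ e e : Matrix a a ℂ →ₗ[ℂ] Matrix b b ℂ) :=
  ⟨fun _ _ _ _ hX => hX.submatrix (Prod.map id e.symm), fun _ =>
    Fintype.sum_equiv e.symm _ _ fun _ => rfl⟩

end IsChannel

/-- The completely depolarizing map `X ↦ Tr[X] 1 / |b|`. -/
def depolarizing (a b : Type) [Fintype a] [DecidableEq a] [Fintype b] [DecidableEq b] : OpMap a b :=
  measPrep 1 ((Fintype.card b : ℂ)⁻¹ • 1)

theorem choi_depolarizing [Fintype a] [DecidableEq a] [Fintype b] [DecidableEq b] :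
    choi (depolarizing a b) = (Fintype.card b : ℂ)⁻¹ • 1 := by
  rw [← Matrix.one_kronecker_one, ← Matrix.kronecker_smul]
  ext p q
  rw [choi_apply, depolarizing, measPrep_apply, one_mul, Matrix.smul_apply,
    Matrix.kroneckerMap_apply]
  obtain h | h := eq_or_ne p.1 q.1
  · rw [h, Matrix.trace_single_eq_same, one_smul, Matrix.one_apply_eq, one_mul, Matrix.smul_apply]
  · rw [Matrix.trace_single_eq_of_ne _ _ _ h, zero_smul, Matrix.one_apply_ne h, zero_mul]

theorem isChannel_depolarizing [Fintype a] [DecidableEq a] [Fintype b] [DecidableEq b]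
    [Nonempty b] : IsChannel (depolarizing a b) := by
  refine ⟨isCompletelyPositive_of_choi ?_, fun X => ?_⟩
  · rw [choi_depolarizing]
    exact Matrix.PosSemidef.one.smul (by positivity)
  · simp [depolarizing, measPrep_apply, Matrix.trace_smul]

/-- The map `X ↦ N(X†)†`; it equals `N` exactly when `N` preserves Hermiticity. -/
def conjMap (N : OpMap a b) : OpMap a b where
  toFun X := (N Xᴴ)ᴴ
  map_add' X Y := by simp
  map_smul' t X := by simp [Matrix.conjTranspose_smul]

theorem conjMap_apply (N : OpMap a b) (X : Matrix a a ℂ) : conjMap N X = (N Xᴴ)ᴴ := rfl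

theorem isHermitian_choi [Fintype a] [DecidableEq a] {N : OpMap a b} (hN : conjMap N = N) :
    (choi N).IsHermitian := by
  ext p q
  have adjoint_image : N (Matrix.single q.1 p.1 1) = (N (Matrix.single p.1 q.1 1))ᴴ := by
    conv_lhs => rw [← hN, conjMap_apply, Matrix.conjTranspose_single, star_one]
  rw [Matrix.conjTranspose_apply, choi_apply, choi_apply, adjoint_image,
    Matrix.conjTranspose_apply, star_star]

/- The Choi operator of the depolarizing map is a positive multiple of the identity, so it stays
positive semidefinite under a small Hermitian perturbation. -/
theorem exists_isChannel_eq_smul_sub [Fintype a] [DecidableEq a] [Fintype b] [DecidableEq b]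
    [Nonempty b] {N : OpMap a b} (hN : conjMap N = N) (htr : ∀ X, (N X).trace = 0) :
    ∃ (t : ℂ) (M : OpMap a b), IsChannel M ∧ N = t • (M - depolarizing a b) := by
  obtain ⟨t, ht, hpos⟩ := exists_posSemidef_add_smul_one (isHermitian_choi hN)
  have card_mul_pos : (0 : ℂ) < Fintype.card b * t := by positivity
  refine ⟨Fintype.card b * t, depolarizing a b + (Fintype.card b * t : ℂ)⁻¹ • N,
    ⟨isCompletelyPositive_of_choi ?_, fun X => ?_⟩, ?_⟩
  · have choi_eq : choi (depolarizing a b + (Fintype.card b * t : ℂ)⁻¹ • N) =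
        (Fintype.card b * t : ℂ)⁻¹ • (choi N + (t : ℂ) • 1) := by
      have choi_add : choi (depolarizing a b + (Fintype.card b * t : ℂ)⁻¹ • N) =
          choi (depolarizing a b) + (Fintype.card b * t : ℂ)⁻¹ • choi N := by
        ext p q
        simp only [choi_apply, Matrix.add_apply, Matrix.smul_apply, LinearMap.add_apply,
          LinearMap.smul_apply]
      have t_ne_zero : (t : ℂ) ≠ 0 := Complex.ofReal_ne_zero.2 ht.ne'
      rw [choi_add, choi_depolarizing, smul_add, smul_smul, mul_inv,
        inv_mul_cancel_right₀ t_ne_zero, add_comm]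
    rw [choi_eq]
    exact hpos.smul (inv_nonneg.2 card_mul_pos.le)
  · simp [isChannel_depolarizing.2, htr]
  · rw [add_sub_cancel_left, smul_inv_smul₀ card_mul_pos.ne']

end CompletePositivity

/-! ### Superchannels and the trace -/

namespace IsSuperchannel

variable {a b c d : Type} [Fintype a] [Fintype b] [Fintype c] [Fintype d] {Ξ : SuperMap a b c d}

theorem trace_apply_of_isChannel (hΞ : IsSuperchannel Ξ) {N : OpMap a b} (hN : IsChannel N)
    (V : Matrix c c ℂ) : (Ξ N V).trace = V.trace := by
  have contractMap_idTensor : contractMap 1 1 (idTensor Unit N) = N := by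
    ext X : 1
    rw [contractMap_apply, partialContract_idTensor, partialContract_kronecker]
    simp
  conv_lhs => rw [← contractMap_idTensor, ← partialContract_idTensorSuper,
    trace_partialContract_one, (hΞ Unit _ hN.idTensor).2, Matrix.trace_kronecker]
  simp

theorem trace_apply_eq_zero [Nonempty b] (hΞ : IsSuperchannel Ξ) {N : OpMap a b}
    (hN : ∀ X, (N X).trace = 0) (V : Matrix c c ℂ) : (Ξ N V).trace = 0 := by
  classical
  have of_conj_invariant : ∀ M : OpMap a b, conjMap M = M → (∀ X, (M X).trace = 0) →
      (Ξ M V).trace = 0 := by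
    intro M hconj htr
    obtain ⟨t, M', hM', rfl⟩ := exists_isChannel_eq_smul_sub hconj htr
    rw [map_smul, map_sub, LinearMap.smul_apply, LinearMap.sub_apply, Matrix.trace_smul,
      Matrix.trace_sub, hΞ.trace_apply_of_isChannel hM',
      hΞ.trace_apply_of_isChannel isChannel_depolarizing, sub_self, smul_zero]
  have hconj : ∀ X, (conjMap N X).trace = 0 := fun X => by
    rw [conjMap_apply, Matrix.trace_conjTranspose, hN, star_zero]
  have real_part := of_conj_invariant (N + conjMap N)
    (by ext X : 1; simp [conjMap_apply, add_comm]) (fun X => by simp [hN, hconj])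
  have imaginary_part := of_conj_invariant (Complex.I • (N - conjMap N))
    (by
      ext X : 1
      simp only [conjMap_apply, LinearMap.smul_apply, LinearMap.sub_apply,
        Matrix.conjTranspose_smul, Matrix.conjTranspose_sub, Matrix.conjTranspose_conjTranspose,
        RCLike.star_def, Complex.conj_I, neg_smul, ← smul_neg, neg_sub])
    (fun X => by simp [hN, hconj])
  have decomposition : N = (2⁻¹ : ℂ) • (N + conjMap N) +
      (-Complex.I / 2) • (Complex.I • (N - conjMap N)) := by
    rw [smul_smul, div_mul_eq_mul_div, neg_mul, Complex.I_mul_I, neg_neg, one_div, ← smul_add,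
      add_add_sub_cancel, ← two_smul ℂ N, smul_smul, inv_mul_cancel₀ two_ne_zero, one_smul]
  rw [decomposition, map_add, map_smul, map_smul _ (-Complex.I / 2), LinearMap.add_apply,
    LinearMap.smul_apply, LinearMap.smul_apply, Matrix.trace_add, Matrix.trace_smul,
    Matrix.trace_smul, real_part, imaginary_part, smul_zero, smul_zero, add_zero]

theorem trace_apply_of_trace [Nonempty b] (hΞ : IsSuperchannel Ξ) {N : OpMap a b}
    (hN : ∀ X, (N X).trace = X.trace) (V : Matrix c c ℂ) : (Ξ N V).trace = V.trace := by
  classical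
  have depolarizing_channel : IsChannel (depolarizing a b) := isChannel_depolarizing
  have trace_difference := hΞ.trace_apply_eq_zero (N := N - depolarizing a b)
    (fun X => by simp [hN, depolarizing_channel.2]) V
  rwa [map_sub, LinearMap.sub_apply, Matrix.trace_sub,
    hΞ.trace_apply_of_isChannel depolarizing_channel, sub_eq_zero] at trace_difference

end IsSuperchannel

namespace QSystem

/-! ### Discrete Wigner functions of maps -/

section MapWigner

variable {R A B : QSystem}

/-- The discrete Wigner function `W_N(v | u) = (1/d_B) Tr[A_v N(A_u)]` of a map `N : A → B`. -/
def mapWigner (A B : QSystem) (N : OpMap A.Basis B.Basis) (v : B.Phase) (u : A.Phase) : ℂ :=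
  B.wigner (N (A.phasePoint u)) v

theorem wigner_tensor (X : (R.tensor A).Op) (r : R.Phase) (u : A.Phase) :
    (R.tensor A).wigner X (r, u) =
      1 / (R.dim : ℂ) * A.wigner (partialContract (R.phasePoint r) X) u := by
  rw [wigner, phasePoint_tensor, dim_tensor, wigner, Nat.cast_mul, ← mul_assoc, one_div_mul_one_div]
  exact congrArg _ (trace_kronecker_mul (R.phasePoint r) (A.phasePoint u) X)

theorem wigner_kronecker (X : R.Op) (Y : A.Op) (r : R.Phase) (u : A.Phase) :
    (R.tensor A).wigner (X ⊗ₖ Y) (r, u) = R.wigner X r * A.wigner Y u := by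
  rw [wigner_tensor, partialContract_kronecker, wigner_smul, ← mul_assoc]
  rfl

theorem wigner_apply (N : OpMap A.Basis B.Basis) (X : A.Op) (v : B.Phase) :
    B.wigner (N X) v = ∑ u, A.wigner X u * mapWigner A B N v u := by
  conv_lhs => rw [← A.sum_wigner_smul_phasePoint X]
  simp only [map_sum, map_smul, wigner_sum, wigner_smul, mapWigner]

theorem wigner_idTensor (N : OpMap A.Basis B.Basis) (X : (R.tensor A).Op) (r : R.Phase)
    (v : B.Phase) :
    (R.tensor B).wigner (idTensor R.Basis N X) (r, v) =
      ∑ u, (R.tensor A).wigner X (r, u) * mapWigner A B N v u := by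
  simp only [wigner_tensor, partialContract_idTensor, wigner_apply N, Finset.mul_sum, mul_assoc]

theorem wigner_choi (N : OpMap A.Basis B.Basis) (u : A.Phase) (v : B.Phase) :
    (A.tensor B).wigner (choi N) (u, v) = 1 / (A.dim : ℂ) * mapWigner A B N v (A.reflect u) := by
  rw [wigner_tensor, partialContract_choi, ← phasePoint_reflect]
  rfl

end MapWigner

end QSystem

open QSystem

/-! ### Maps preserving the positivity of Wigner functions -/

section CPWP

variable {A B : QSystem} {N : OpMap A.Basis B.Basis}

theorem IsChannel.isCPWP (hN : IsChannel N) (h : ∀ v u, 0 ≤ mapWigner A B N v u) :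
    IsCPWP A B N := by
  refine ⟨hN.1.isHermiticityPreserving, fun R ρ ⟨hpos, htr, hρ⟩ => ⟨hN.1 _ _ hpos, ?_, ?_⟩⟩
  · exact (hN.idTensor.2 ρ).trans htr
  · rintro ⟨r, v⟩
    rw [wigner_idTensor]
    exact Finset.sum_nonneg fun u _ => mul_nonneg (hρ _) (h v u)

/-- The maximally entangled state of two copies of a system. -/
def maxEntangled (A : QSystem) : (A.tensor A).Op :=
  (1 / (A.dim : ℂ)) • choi (LinearMap.id : OpMap A.Basis A.Basis)

theorem choi_id {a : Type} [Fintype a] [DecidableEq a] :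
    choi (LinearMap.id : OpMap a a) =
      Matrix.vecMulVec (fun p => if p.1 = p.2 then 1 else 0)
        (star fun p => if p.1 = p.2 then 1 else 0) := by
  ext p q
  rw [choi_apply, LinearMap.id_apply, Matrix.single_apply, Matrix.vecMulVec_apply,
    Pi.star_apply, apply_ite star, star_one, star_zero, ite_and]
  split_ifs <;> simp

theorem mapWigner_id (u v : A.Phase) :
    mapWigner A A LinearMap.id v u = if u = v then 1 else 0 :=
  A.wigner_phasePoint u v

theorem maxEntangled_mem_wignerStates (A : QSystem) :
    maxEntangled A ∈ (A.tensor A).wignerStates := by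
  refine ⟨?_, ?_, ?_⟩
  · rw [maxEntangled, choi_id]
    exact (Matrix.posSemidef_vecMulVec_self_star _).smul A.one_div_dim_pos.le
  · rw [maxEntangled, Matrix.trace_smul, ← trace_partialContract_one, partialContract_choi,
      Matrix.transpose_one, LinearMap.id_apply, Matrix.trace_one, smul_eq_mul, ← dim,
      one_div_mul_cancel A.dim_ne_zero]
  · rintro ⟨u, v⟩
    rw [maxEntangled, wigner_smul, wigner_choi, mapWigner_id]
    have := A.one_div_dim_pos.le
    split_ifs <;> positivity

theorem idTensor_maxEntangled (N : OpMap A.Basis B.Basis) :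
    idTensor A.Basis N (maxEntangled A) = (1 / (A.dim : ℂ)) • choi N := by
  rw [maxEntangled, map_smul, choi, choi]
  simp only [map_sum, idTensor_kronecker, LinearMap.id_apply]

theorem IsCPWP.mapWigner_nonneg (hN : IsCPWP A B N) (v : B.Phase) (u : A.Phase) :
    0 ≤ mapWigner A B N v u := by
  have image_nonneg := (hN.2 A _ (maxEntangled_mem_wignerStates A)).2.2 (A.reflect u, v)
  rw [idTensor_maxEntangled, wigner_smul, wigner_choi, reflect_reflect,
    ← inv_mul_le_iff₀ A.one_div_dim_pos, mul_zero, ← inv_mul_le_iff₀ A.one_div_dim_pos,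
    mul_zero] at image_nonneg
  exact image_nonneg

end CPWP

/-! ### Discrete Wigner functions of supermaps -/

section SuperWigner

variable {R A B C D : QSystem} (Ξ : SuperMap A.Basis B.Basis C.Basis D.Basis)

theorem opMap_eq_sum_measPrep (N : OpMap A.Basis B.Basis) :
    N = ∑ u, ∑ v, (1 / (A.dim : ℂ) * mapWigner A B N v u) •
      measPrep (A.phasePoint u) (B.phasePoint v) := by
  ext1 X
  conv_lhs => rw [← A.sum_wigner_smul_phasePoint X, map_sum]
  simp only [LinearMap.sum_apply, map_smul, LinearMap.smul_apply, measPrep_apply]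
  refine Finset.sum_congr rfl fun u _ => ?_
  conv_lhs => rw [← B.sum_wigner_smul_phasePoint (N (A.phasePoint u)), Finset.smul_sum]
  refine Finset.sum_congr rfl fun v _ => ?_
  rw [smul_smul, smul_smul, wigner, mapWigner, mul_right_comm]

theorem superWigner_eq (uA : A.Phase) (vD : D.Phase) (uC : C.Phase) (vB : B.Phase) :
    superWigner Ξ uA vD uC vB = 1 / (A.dim : ℂ) *
      mapWigner C D (Ξ (measPrep (A.phasePoint uA) (B.phasePoint vB))) vD uC := by
  rw [superWigner, trace_kronecker_mul, partialContract_bipartiteMap, mapWigner, wigner,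
    ← mul_assoc, one_div_mul_one_div]

theorem mapWigner_apply (N : OpMap A.Basis B.Basis) (vD : D.Phase) (uC : C.Phase) :
    mapWigner C D (Ξ N) vD uC =
      ∑ uA, ∑ vB, superWigner Ξ uA vD uC vB * mapWigner A B N vB uA := by
  conv_lhs => rw [opMap_eq_sum_measPrep N]
  simp only [mapWigner, map_sum, map_smul, LinearMap.sum_apply, LinearMap.smul_apply,
    wigner_sum, wigner_smul, superWigner_eq, mul_right_comm]

theorem mapWigner_contractMap (N : OpMap (R.tensor A).Basis (R.tensor B).Basis) (r r' : R.Phase)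
    (u : A.Phase) (v : B.Phase) :
    mapWigner (R.tensor A) (R.tensor B) N (r', v) (r, u) = 1 / (R.dim : ℂ) *
      mapWigner A B (contractMap (R.phasePoint r') (R.phasePoint r) N) v u := by
  rw [mapWigner, wigner_tensor, phasePoint_tensor]
  rfl

theorem mapWigner_idTensorSuper (N : OpMap (R.tensor A).Basis (R.tensor B).Basis)
    (r r' : R.Phase) (uC : C.Phase) (vD : D.Phase) :
    mapWigner (R.tensor C) (R.tensor D) (idTensorSuper R.Basis Ξ N) (r', vD) (r, uC) =
      ∑ uA, ∑ vB, superWigner Ξ uA vD uC vB *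
        mapWigner (R.tensor A) (R.tensor B) N (r', vB) (r, uA) := by
  rw [mapWigner, wigner_tensor, phasePoint_tensor, partialContract_idTensorSuper]
  simp only [mapWigner_contractMap, mul_left_comm _ (1 / (R.dim : ℂ)), ← Finset.mul_sum]
  exact congrArg _ (mapWigner_apply Ξ _ vD uC)

end SuperWigner

/-! ### A channel detecting a single value of `W_Ξ` -/

section Routing

variable {a b : Type} [Fintype a] [DecidableEq a] [Fintype b] [DecidableEq b]

/-- The channel `AB ⊗ A → AB ⊗ B` that moves the second copy of `A` to the reference system and `B`
out of it, discards the first copy of `A` and replaces `B` by the maximally mixed state. -/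
def routing (a b : Type) [Fintype a] [DecidableEq a] [Fintype b] [DecidableEq b] :
    OpMap ((a × b) × a) ((a × b) × b) :=
  let exchangeInputs : (a × b) × a ≃ (a × b) × a :=
    ⟨fun p => ((p.2, p.1.2), p.1.1), fun p => ((p.2, p.1.2), p.1.1), fun _ => rfl, fun _ => rfl⟩
  let exchangeOutputs : (a × b) × b ≃ (a × b) × b :=
    ⟨fun p => ((p.1.1, p.2), p.1.2), fun p => ((p.1.1, p.2), p.1.2), fun _ => rfl, fun _ => rfl⟩
  (Matrix.reindexLinearEquiv ℂ ℂ exchangeOutputs exchangeOutputs).toLinearMap ∘ₗ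
    idTensor (a × b) (depolarizing a b) ∘ₗ
    (Matrix.reindexLinearEquiv ℂ ℂ exchangeInputs exchangeInputs).toLinearMap

theorem isChannel_routing [Nonempty b] : IsChannel (routing a b) :=
  (IsChannel.reindex _).comp (isChannel_depolarizing.idTensor.comp (IsChannel.reindex _))

theorem routing_kronecker (V W : Matrix a a ℂ) (Y : Matrix b b ℂ) :
    routing a b ((V ⊗ₖ Y) ⊗ₖ W) = (V.trace * (Fintype.card b : ℂ)⁻¹) • ((W ⊗ₖ 1) ⊗ₖ Y) := by
  have exchanged : ((V ⊗ₖ Y) ⊗ₖ W).submatrix (fun p => ((p.2, p.1.2), p.1.1))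
      (fun p => ((p.2, p.1.2), p.1.1)) = (W ⊗ₖ Y) ⊗ₖ V := by
    ext p q
    simp only [Matrix.submatrix_apply, Matrix.kroneckerMap_apply]
    ring
  have unfolded : routing a b ((V ⊗ₖ Y) ⊗ₖ W) =
      (idTensor (a × b) (depolarizing a b) (((V ⊗ₖ Y) ⊗ₖ W).submatrix
        (fun p => ((p.2, p.1.2), p.1.1)) (fun p => ((p.2, p.1.2), p.1.1)))).submatrix
          (fun p => ((p.1.1, p.2), p.1.2)) (fun p => ((p.1.1, p.2), p.1.2)) := rfl
  rw [unfolded, exchanged, idTensor_kronecker]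
  ext p q
  simp only [depolarizing, measPrep_apply, one_mul, Matrix.submatrix_apply,
    Matrix.kroneckerMap_apply, Matrix.smul_apply, smul_eq_mul]
  ring

theorem mapWigner_routing (A B : QSystem) (a a' u : A.Phase) (b b' v : B.Phase) :
    mapWigner ((A.tensor B).tensor A) ((A.tensor B).tensor B) (routing A.Basis B.Basis)
        ((a', b'), v) ((a, b), u) =
      (1 / (B.dim : ℂ)) ^ 2 * if u = a' ∧ b = v then 1 else 0 := by
  have output : routing A.Basis B.Basis (((A.tensor B).tensor A).phasePoint ((a, b), u)) =
      (1 / (B.dim : ℂ)) • ((A.phasePoint u ⊗ₖ (1 : B.Op)) ⊗ₖ B.phasePoint b) := by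
    rw [phasePoint_tensor, phasePoint_tensor]
    refine (routing_kronecker _ _ _).trans ?_
    rw [trace_phasePoint, one_mul, one_div]
    rfl
  rw [mapWigner, output, wigner_smul]
  have factor := (wigner_kronecker (R := A.tensor B) (A.phasePoint u ⊗ₖ (1 : B.Op))
    (B.phasePoint b) (a', b') v).trans
      (congrArg (· * B.wigner (B.phasePoint b) v) (wigner_kronecker (A.phasePoint u) 1 a' b'))
  refine (congrArg _ factor).trans ?_
  rw [wigner_phasePoint, wigner_phasePoint, wigner_one, ite_and]
  split_ifs <;> ring

end Routing

/-! ### CPWP superchannels -/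

section CPWPSuper

variable {A B C D : QSystem} {Ξ : SuperMap A.Basis B.Basis C.Basis D.Basis}

theorem IsSuperchannel.isCPWPSuper (hΞ : IsSuperchannel Ξ)
    (h : ∀ uA vD uC vB, 0 ≤ superWigner Ξ uA vD uC vB) : IsCPWPSuper Ξ := by
  intro R N hN hW
  refine IsChannel.isCPWP (A := R.tensor C) (B := R.tensor D) (hΞ R.Basis N hN) ?_
  rintro ⟨r', vD⟩ ⟨r, uC⟩
  rw [mapWigner_idTensorSuper]
  exact Finset.sum_nonneg fun uA _ => Finset.sum_nonneg fun vB _ =>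
    mul_nonneg (h uA vD uC vB) (hW.mapWigner_nonneg _ _)

theorem isCPWP_routing (A B : QSystem) :
    IsCPWP ((A.tensor B).tensor A) ((A.tensor B).tensor B) (routing A.Basis B.Basis) := by
  refine IsChannel.isCPWP (A := (A.tensor B).tensor A) (B := (A.tensor B).tensor B)
    isChannel_routing ?_
  rintro ⟨⟨a', b'⟩, v⟩ ⟨⟨a, b⟩, u⟩
  rw [mapWigner_routing]
  exact mul_nonneg (pow_nonneg B.one_div_dim_pos.le 2) (by split_ifs <;> simp)

theorem mapWigner_idTensorSuper_routing (Ξ : SuperMap A.Basis B.Basis C.Basis D.Basis)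
    (uA : A.Phase) (vD : D.Phase) (uC : C.Phase) (vB : B.Phase) :
    mapWigner ((A.tensor B).tensor C) ((A.tensor B).tensor D)
        (idTensorSuper (A.tensor B).Basis Ξ (routing A.Basis B.Basis))
        ((uA, vB), vD) ((uA, vB), uC) =
      (1 / (B.dim : ℂ)) ^ 2 * superWigner Ξ uA vD uC vB := by
  refine (mapWigner_idTensorSuper Ξ (R := A.tensor B) _ _ _ uC vD).trans ?_
  have routed : ∀ u v, superWigner Ξ u vD uC v *
      mapWigner ((A.tensor B).tensor A) ((A.tensor B).tensor B) (routing A.Basis B.Basis)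
        ((uA, vB), v) ((uA, vB), u) =
      if u = uA then if vB = v then (1 / (B.dim : ℂ)) ^ 2 * superWigner Ξ u vD uC v else 0 else 0 :=
    fun u v => by rw [mapWigner_routing, ← ite_and, mul_left_comm, mul_ite, mul_one, mul_zero,
      mul_ite, mul_zero]
  refine (Finset.sum_congr rfl fun u _ => Finset.sum_congr rfl fun v _ => routed u v).trans ?_
  simp only [Finset.sum_ite_eq, Finset.sum_ite_eq', Finset.sum_ite_irrel, Finset.sum_const_zero,
    Finset.mem_univ, if_true]

theorem IsCPWPSuper.superWigner_nonneg (h : IsCPWPSuper Ξ)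
    (uA : A.Phase) (vD : D.Phase) (uC : C.Phase) (vB : B.Phase) :
    0 ≤ superWigner Ξ uA vD uC vB := by
  have image_nonneg := (h (A.tensor B) _ isChannel_routing (isCPWP_routing A B)).mapWigner_nonneg
    ((uA, vB), vD) ((uA, vB), uC)
  rw [mapWigner_idTensorSuper_routing, ← inv_mul_le_iff₀ (pow_pos B.one_div_dim_pos 2),
    mul_zero] at image_nonneg
  exact image_nonneg

end CPWPSuper

/-! ### The Choi operator of a supermap and the non-signalling condition -/

section NonSignalling

variable {A B C D : QSystem} {Ξ : SuperMap A.Basis B.Basis C.Basis D.Basis}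

theorem wigner_choi_bipartiteMap (Ξ : SuperMap A.Basis B.Basis C.Basis D.Basis)
    (uC : C.Phase) (vB : B.Phase) (uA : A.Phase) (vD : D.Phase) :
    ((C.tensor B).tensor (A.tensor D)).wigner (choi (bipartiteMap Ξ)) ((uC, vB), (uA, vD)) =
      1 / ((C.tensor B).dim : ℂ) * superWigner Ξ uA vD (C.reflect uC) (B.reflect vB) := by
  refine (wigner_choi (A := C.tensor B) (B := A.tensor D) (bipartiteMap Ξ) _ _).trans ?_
  rw [mapWigner, wigner, superWigner, reflect, phasePoint_tensor, phasePoint_tensor,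
    dim_tensor A D, Nat.cast_mul]

theorem wigner_choi_bipartiteMap_nonneg_iff :
    (∀ u, 0 ≤ ((C.tensor B).tensor (A.tensor D)).wigner (choi (bipartiteMap Ξ)) u) ↔
      ∀ uA vD uC vB, 0 ≤ superWigner Ξ uA vD uC vB := by
  have nonneg_iff : ∀ uA vD uC vB,
      0 ≤ ((C.tensor B).tensor (A.tensor D)).wigner (choi (bipartiteMap Ξ)) ((uC, vB), (uA, vD)) ↔
        0 ≤ superWigner Ξ uA vD (C.reflect uC) (B.reflect vB) := fun uA vD uC vB => by
    rw [wigner_choi_bipartiteMap, ← inv_mul_le_iff₀ (C.tensor B).one_div_dim_pos, mul_zero]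
  constructor
  · intro h uA vD uC vB
    simpa only [reflect_reflect] using (nonneg_iff uA vD (C.reflect uC) (B.reflect vB)).1 (h _)
  · rintro h ⟨⟨uC, vB⟩, ⟨uA, vD⟩⟩
    exact (nonneg_iff uA vD uC vB).2 (h _ _ _ _)

theorem sum_superWigner (Ξ : SuperMap A.Basis B.Basis C.Basis D.Basis) (uA : A.Phase)
    (uC : C.Phase) (vB : B.Phase) :
    ∑ vD, superWigner Ξ uA vD uC vB = 1 / (A.dim : ℂ) *
      (Ξ (measPrep (A.phasePoint uA) (B.phasePoint vB)) (C.phasePoint uC)).trace := by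
  simp only [superWigner_eq, mapWigner, ← Finset.mul_sum, sum_wigner]

theorem sum_measPrep_phasePoint (A : QSystem) {b : Type} (Y : Matrix b b ℂ) :
    ∑ u, measPrep (A.phasePoint u) Y = (A.dim : ℂ) • measPrep (1 : A.Op) Y := by
  ext X : 1
  simp only [LinearMap.sum_apply, LinearMap.smul_apply, measPrep_apply, ← Finset.sum_smul,
    ← Matrix.trace_sum, ← Matrix.sum_mul, sum_phasePoint, Matrix.smul_mul, Matrix.trace_smul,
    smul_assoc]

theorem IsSuperchannel.sum_sum_superWigner (hΞ : IsSuperchannel Ξ) (uC : C.Phase) (vB : B.Phase) :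
    ∑ uA, ∑ vD, superWigner Ξ uA vD uC vB = 1 := by
  have trace_measPrep : ∀ X, (measPrep (1 : A.Op) (B.phasePoint vB) X).trace = X.trace :=
    fun X => by rw [measPrep_apply, Matrix.trace_smul, trace_phasePoint, smul_eq_mul, mul_one,
      one_mul]
  simp only [sum_superWigner]
  rw [← Finset.mul_sum, ← Matrix.trace_sum, ← LinearMap.sum_apply, ← map_sum,
    sum_measPrep_phasePoint, map_smul, LinearMap.smul_apply, Matrix.trace_smul,
    hΞ.trace_apply_of_trace trace_measPrep, trace_phasePoint, smul_eq_mul, mul_one,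
    one_div_mul_cancel A.dim_ne_zero]

theorem IsSuperchannel.sum_superWigner_eq (hΞ : IsSuperchannel Ξ) (uA : A.Phase) (uC : C.Phase)
    (vB vB' : B.Phase) :
    ∑ vD, superWigner Ξ uA vD uC vB = ∑ vD, superWigner Ξ uA vD uC vB' := by
  have trace_difference := hΞ.trace_apply_eq_zero
    (N := measPrep (A.phasePoint uA) (B.phasePoint vB) -
      measPrep (A.phasePoint uA) (B.phasePoint vB'))
    (fun X => by simp [measPrep_apply, trace_phasePoint]) (C.phasePoint uC)
  rw [map_sub, LinearMap.sub_apply, Matrix.trace_sub, sub_eq_zero] at trace_difference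
  rw [sum_superWigner, sum_superWigner, trace_difference]

end NonSignalling

end

theorem mainTheorem2 (A B C D : QSystem) (Ξ : SuperMap A.Basis B.Basis C.Basis D.Basis)
    (hΞ : IsSuperchannel Ξ) :
    List.TFAE [
      IsCPWPSuper Ξ,
      ∀ u, 0 ≤ ((C.tensor B).tensor (A.tensor D)).wigner (choi (bipartiteMap Ξ)) u,
      ∀ (uA : A.Phase) (vD : D.Phase) (uC : C.Phase) (vB : B.Phase),
        0 ≤ superWigner Ξ uA vD uC vB,
      IsNonsignallingChannel (superWigner Ξ)] := by
  tfae_have 1 → 3 := IsCPWPSuper.superWigner_nonneg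
  tfae_have 3 → 1 := hΞ.isCPWPSuper
  tfae_have 2 ↔ 3 := wigner_choi_bipartiteMap_nonneg_iff
  tfae_have 3 → 4 := fun h => ⟨h, hΞ.sum_sum_superWigner, hΞ.sum_superWigner_eq⟩
  tfae_have 4 → 3 := fun h => h.1
  tfae_finish
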